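/- Identify the Euclidean plane with $\mathbb{C}$. For $c\in\mathbb{C}$, $A\ge B\ge 0$ and $\varphi\in\mathbb{R}$ call $\{\,c+e^{i\varphi}(A\cos t+iB\sin t) : t\in\mathbb{R}\,\}$ the ellipse with centre $c$ and semi-axes $A,B$; it is non-degenerate if $B>0$ (circles are included), and degenerates to a segment or a point if $B=0$. Let $\mathcal{E}$ and $\mathcal{E}_c$ be non-degenerate ellipses in the plane, with $\mathcal{E}_c$ contained in the open region bounded by $\mathcal{E}$, and otherwise in arbitrary position (in particular, they may be non-concentric and non-axis-aligned). A 3-periodic of the pair is a non-degenerate triangle with vertices on $\mathcal{E}$ whose three side lines are tangent to $\mathcal{E}_c$. Suppose that the pair admits a 3-periodic. Then for all $\alpha,\beta\in\mathbb{C}$ the locus of $\alpha X_2+\beta X_3$ over all 3-periodics of the pair, where $X_2$ is the barycenter and $X_3$ the circumcenter, is an ellipse, possibly degenerate. Moreover, there are $h_{11},h_{22}\in\mathbb{R}$ and $h_{12}\in\mathbb{C}$, depending only on the pair, such that for all $\alpha,\beta$ this ellipse is non-degenerate if and only if $$h_{11}|\alpha|^2+2\,\mathrm{Re}(h_{12}\,\alpha\overline{\beta})+h_{22}|\beta|^2\neq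 0,$$ and $h_{22}\ne 0$ whenever $\mathcal{E}$ is not a circle. So if $\mathcal{E}$ is not a circle, the locus of $X_3$ is a non-degenerate ellipse, and the locus is a non-degenerate ellipse for generic $(\alpha,\beta)$. -/

import Mathlib

/-- The curve with centre `c`, semi-axes `a`, `b` and first axis in direction `exp (i θ)`.
For `0 < b ≤ a` it is an ellipse, for `b = 0 < a` a segment, for `a = b = 0` a point. -/
def ellipseCurve (c : ℂ) (a b θ : ℝ) : Set ℂ :=
  Set.range fun t : ℝ =>
    c + Complex.exp (θ * Complex.I) * (a * Real.cos t + b * Real.sin t * Complex.I)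

/-- A (non-degenerate) ellipse in the Euclidean plane `ℂ`, circles included: centre, semi-axes
`0 < b ≤ a`, and the angle `θ` of the major axis. -/
structure Ellipse where
  center : ℂ
  a : ℝ
  b : ℝ
  θ : ℝ
  b_pos : 0 < b
  b_le_a : b ≤ a

namespace Ellipse

/-- The points of the ellipse. -/
def curve (E : Ellipse) : Set ℂ := ellipseCurve E.center E.a E.b E.θ

/-- The open region bounded by the ellipse. -/
def inside (E : Ellipse) : Set ℂ :=
  {z | ((Complex.exp (-(E.θ * Complex.I)) * (z - E.center)).re / E.a) ^ 2 +
       ((Complex.exp (-(E.θ * Complex.I)) * (z - E.center)).im / E.b) ^ 2 < 1}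

/-- A line is tangent to an ellipse when it meets it in exactly one point. -/
def IsTangentLine (E : Ellipse) (l : AffineSubspace ℝ ℂ) : Prop :=
  ∃! z : ℂ, z ∈ l ∧ z ∈ E.curve

end Ellipse

/-- A 3-periodic of the pair `E` (outer), `Ec` (inner): a triangle inscribed in `E` whose three
side lines are tangent to `Ec`. -/
def IsThreePeriodic (E Ec : Ellipse) (T : Affine.Triangle ℝ ℂ) : Prop :=
  (∀ i, T.points i ∈ E.curve) ∧
    ∀ i j, i ≠ j → Ec.IsTangentLine (affineSpan ℝ {T.points i, T.points j})

/-- The locus of `α X₂ + β X₃` (barycenter and circumcenter) over all 3-periodics of the pair. -/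
def centerLocus (E Ec : Ellipse) (α β : ℂ) : Set ℂ :=
  {X | ∃ T : Affine.Triangle ℝ ℂ, IsThreePeriodic E Ec T ∧
    X = α * T.centroid + β * T.circumcenter}

/-! An affine map carries the unit circle to the outer ellipse, so a triangle inscribed in `E`
becomes a triple of distinct unit numbers `x, y, z`, and the inner ellipse becomes one in the unit
disc with foci `f, g`. Tangency of the chord `x y` is a symmetric biquadratic equation. Three
tangent chords force `x + y + z = f + g + l * conj (f * g)`, where `l = x * y * z`, and a closure
condition on the pair alone (`vieta_of_ponceletForm`). Conversely, for each unit `l` the Blaschke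
equation `w (w - f) (w - g) = l (1 - f̄ w) (1 - ḡ w)` has three distinct unit roots
(`exists_blaschke_triple`), which under the closure condition form a 3-periodic. So `l` runs over
the whole unit circle (`exists_porism_param`).

Barycenter and circumcenter are real-affine in `l`, so the locus is the image of the circle under
some `e ↦ c + v e + w ē`: an ellipse with semi-axes `‖v‖ + ‖w‖` and `|‖v‖ - ‖w‖|`
(`harm_image_circle`). Both `v` and `w` are complex-linear in `(α, β)`, so `‖v‖² - ‖w‖²` is the
required Hermitian form; `circumcenter_coeff_ne` handles its `|β|²` coefficient. -/

open ComplexConjugate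

/-! ### Ellipses as real-affine images of the unit circle. -/

/-- The real-affine map `e ↦ c + u e + v ē` of the plane. -/
def harm (c u v e : ℂ) : ℂ := c + u * e + v * conj e

theorem harm_injective {c u v : ℂ} (h : ‖v‖ < ‖u‖) : Function.Injective (harm c u v) := by
  intro x y hxy
  have h1 : u * (x - y) = -(v * conj (x - y)) := by
    simp only [harm] at hxy
    simp only [map_sub]
    linear_combination hxy
  have h2 : ‖u‖ * ‖x - y‖ = ‖v‖ * ‖x - y‖ := by
    rw [← norm_mul, h1, norm_neg, norm_mul, Complex.norm_conj]
  have h3 : ‖x - y‖ = 0 := by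
    by_contra h0
    exact h.ne' (mul_right_cancel₀ h0 h2)
  exact sub_eq_zero.mp (norm_eq_zero.mp h3)

theorem mul_conj_of_norm_one {w : ℂ} (h : ‖w‖ = 1) : w * conj w = 1 := by
  rw [Complex.mul_conj, Complex.normSq_eq_norm_sq, h]; simp

theorem exists_exp_of_norm_one {w : ℂ} (h : ‖w‖ = 1) :
    ∃ t : ℝ, w = Complex.exp (t * Complex.I) := by
  refine ⟨Complex.arg w, ?_⟩
  have := Complex.norm_mul_exp_arg_mul_I w
  rw [h] at this
  simpa using this.symm

theorem conj_exp_mul_I (t : ℝ) :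
    conj (Complex.exp (t * Complex.I)) = Complex.exp (-(t * Complex.I)) := by
  rw [← Complex.exp_conj]; simp

theorem ellipseCurve_eq_image (c : ℂ) (a b θ : ℝ) :
    ellipseCurve c a b θ =
      harm c (Complex.exp (θ * Complex.I) * ((a + b) / 2))
        (Complex.exp (θ * Complex.I) * ((a - b) / 2)) '' {e : ℂ | ‖e‖ = 1} := by
  have key : ∀ t : ℝ, harm c (Complex.exp (θ * Complex.I) * ((a + b) / 2))
        (Complex.exp (θ * Complex.I) * ((a - b) / 2)) (Complex.exp (t * Complex.I)) =
        c + Complex.exp (θ * Complex.I) * (a * Real.cos t + b * Real.sin t * Complex.I) := by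
    intro t
    rw [harm, conj_exp_mul_I, ← neg_mul, Complex.exp_mul_I (-(t : ℂ)), Complex.exp_mul_I (t : ℂ),
      Complex.cos_neg, Complex.sin_neg]
    push_cast
    ring
  ext z
  constructor
  · rintro ⟨t, rfl⟩
    exact ⟨Complex.exp (t * Complex.I), by simp [Complex.norm_exp_ofReal_mul_I], key t⟩
  · rintro ⟨e, he, rfl⟩
    obtain ⟨t, rfl⟩ := exists_exp_of_norm_one he
    exact ⟨t, (key t).symm⟩

theorem exists_unit_mul_norm (z : ℂ) : ∃ t : ℝ, z = ‖z‖ * Complex.exp (t * Complex.I) :=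
  ⟨Complex.arg z, (Complex.norm_mul_exp_arg_mul_I z).symm⟩

/-- Rotating the parameter by half the difference of the arguments of `v` and `w` gives both
coefficients the mean argument, which is the direction of the first axis. -/
theorem harm_image_circle_eq_ellipseCurve (c v w : ℂ) :
    ∃ φ : ℝ, harm c v w '' {e : ℂ | ‖e‖ = 1} =
      ellipseCurve c (‖v‖ + ‖w‖) (‖v‖ - ‖w‖) φ := by
  obtain ⟨μ, hμ⟩ := exists_unit_mul_norm v
  obtain ⟨ν, hν⟩ := exists_unit_mul_norm w
  refine ⟨(μ + ν) / 2, ?_⟩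
  rw [ellipseCurve_eq_image]
  set k := Complex.exp (((μ - ν) / 2 : ℝ) * Complex.I) with hk
  set g := Complex.exp (((μ + ν) / 2 : ℝ) * Complex.I) with hg
  have hk1 : ‖k‖ = 1 := Complex.norm_exp_ofReal_mul_I _
  have hkc := mul_conj_of_norm_one hk1
  have hv : v = ‖v‖ * (g * k) := by
    rw [hg, hk, ← Complex.exp_add]
    conv_lhs => rw [hμ]
    congr 2; push_cast; ring
  have hw : w = ‖w‖ * (g * conj k) := by
    rw [hg, hk, conj_exp_mul_I, ← Complex.exp_add]
    conv_lhs => rw [hν]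
    congr 2; push_cast; ring
  have key : ∀ e, harm c v w e = harm c (g * (((‖v‖ + ‖w‖ : ℝ) + (‖v‖ - ‖w‖ : ℝ)) / 2))
      (g * (((‖v‖ + ‖w‖ : ℝ) - (‖v‖ - ‖w‖ : ℝ)) / 2)) (k * e) := by
    intro e
    simp only [harm, map_mul]
    push_cast
    linear_combination e * hv + conj e * hw
  ext z
  constructor
  · rintro ⟨e, he, rfl⟩
    exact ⟨k * e, by simpa [hk1] using he, (key e).symm⟩
  · rintro ⟨e, he, rfl⟩
    refine ⟨conj k * e, by simpa [hk1] using he, ?_⟩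
    rw [key, ← mul_assoc, hkc, one_mul]

/-- The substitution `e ↦ ē` exchanges `v` and `w`, so the larger coefficient may be taken first. -/
theorem harm_image_circle (c v w : ℂ) :
    ∃ φ : ℝ, harm c v w '' {e : ℂ | ‖e‖ = 1} =
      ellipseCurve c (‖v‖ + ‖w‖) |‖v‖ - ‖w‖| φ := by
  rcases le_total ‖w‖ ‖v‖ with h | h
  · obtain ⟨φ, hφ⟩ := harm_image_circle_eq_ellipseCurve c v w
    exact ⟨φ, by rw [hφ, abs_of_nonneg (sub_nonneg.mpr h)]⟩
  · obtain ⟨φ, hφ⟩ := harm_image_circle_eq_ellipseCurve c w v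
    refine ⟨φ, ?_⟩
    rw [abs_of_nonpos (sub_nonpos.mpr h), neg_sub, add_comm ‖v‖, ← hφ]
    ext z
    constructor
    · rintro ⟨e, he, rfl⟩
      exact ⟨conj e, by simpa using he, by simp [harm]; ring⟩
    · rintro ⟨e, he, rfl⟩
      exact ⟨conj e, by simpa using he, by simp [harm]; ring⟩

/-! ### Tangent chords of the unit circle -/

theorem mem_chord_iff {x y : ℂ} (hx : ‖x‖ = 1) (hy : ‖y‖ = 1) (hxy : x ≠ y) (w : ℂ) :
    (∃ r : ℝ, w = x + r * (y - x)) ↔ w + x * y * conj w = x + y := by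
  have hx' := mul_conj_of_norm_one hx
  have hy' := mul_conj_of_norm_one hy
  constructor
  · rintro ⟨r, rfl⟩
    simp only [map_add, map_mul, map_sub, Complex.conj_ofReal]
    linear_combination (y - r * y) * hx' + r * x * hy'
  · intro h
    have h0 : y - x ≠ 0 := sub_ne_zero.mpr hxy.symm
    -- Collinearity says that this ratio is real; on the unit circle `x̄ = 1/x` and `ȳ = 1/y` turn
    -- that into the chord equation.
    have hr : conj ((w - x) / (y - x)) = (w - x) / (y - x) := by
      have h0' : conj y - conj x ≠ 0 := by
        rw [← map_sub]; exact (map_ne_zero _).mpr h0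
      have hy0 : y ≠ 0 := by rintro rfl; simp at hy
      have hx0 : x ≠ 0 := by rintro rfl; simp at hx
      rw [map_div₀, map_sub, map_sub, div_eq_div_iff h0' h0]
      apply mul_left_cancel₀ (mul_ne_zero hx0 hy0)
      linear_combination (y - x) * h - y * (y - x) * hx' - (w - x) * x * hy'
        + (w - x) * y * hx'
    obtain ⟨r, hr⟩ := Complex.conj_eq_iff_real.mp hr
    refine ⟨r, ?_⟩
    rw [← hr]; field_simp; ring

theorem lead_norm_eq {P u v : ℂ} (hP : ‖P‖ = 1) :
    ‖v + P * conj u‖ = ‖u + P * conj v‖ := by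
  have hP' := mul_conj_of_norm_one hP
  have : v + P * conj u = P * conj (u + P * conj v) := by
    simp only [map_add, map_mul, Complex.conj_conj]
    linear_combination -v * hP'
  rw [this, norm_mul, hP, one_mul, Complex.norm_conj]

theorem lead_ne_zero {P u v : ℂ} (hP : ‖P‖ = 1) (h : ‖v‖ < ‖u‖) : u + P * conj v ≠ 0 := by
  intro h0
  have : ‖u‖ = ‖v‖ := by
    rw [eq_neg_of_add_eq_zero_left h0]; simp [hP]
  exact h.ne this.symm

/-- The roots have product `C / A`, of modulus one, so the partner of a unit root is again a unit
root: uniqueness means a double root. -/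
theorem existsUnique_unit_root_iff {A B C : ℂ} (hA : A ≠ 0) (hAC : ‖C‖ = ‖A‖) :
    (∃! e : ℂ, ‖e‖ = 1 ∧ A * e ^ 2 + B * e + C = 0) ↔ B ^ 2 = 4 * A * C := by
  constructor
  · rintro ⟨e, ⟨he, h⟩, huniq⟩
    have he0 : e ≠ 0 := by rintro rfl; simp at he
    have h2 : C / (A * e) = e := by
      apply huniq
      refine ⟨?_, ?_⟩
      · rw [norm_div, norm_mul, he, hAC, mul_one, div_self (norm_ne_zero_iff.mpr hA)]
      · field_simp
        linear_combination C * h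
    rw [div_eq_iff (mul_ne_zero hA he0)] at h2
    have h3 : B = -2 * A * e := by
      apply mul_right_cancel₀ he0
      linear_combination h - h2
    rw [h3, h2]; ring
  · intro h
    have hA2 : (2 * A) ≠ 0 := mul_ne_zero two_ne_zero hA
    have hnorm : ‖-B / (2 * A)‖ = 1 := by
      have h1 : ‖B‖ ^ 2 = (2 * ‖A‖) ^ 2 := by
        have := congrArg norm h
        simp only [norm_pow, norm_mul, hAC] at this
        rw [this]; norm_num; ring
      have h2 : ‖B‖ = 2 * ‖A‖ := by
        rwa [sq_eq_sq₀ (norm_nonneg _) (by positivity)] at h1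
      rw [norm_div, norm_neg, norm_mul, h2]
      have := norm_ne_zero_iff.mpr hA
      simp [this]
    refine ⟨-B / (2 * A), ⟨hnorm, ?_⟩, ?_⟩
    · field_simp
      linear_combination -h
    · rintro e ⟨-, he⟩
      rw [eq_div_iff hA2]
      have : (2 * A * e + B) ^ 2 = 0 := by linear_combination 4 * A * he + h
      linear_combination pow_eq_zero_iff (two_ne_zero) |>.mp this

/-- The condition for the chord `x y` of the unit circle to touch the ellipse
`e ↦ c + u e + v ē`. -/
def TangentChord (c u v x y : ℂ) : Prop :=
  (c + x * y * conj c - (x + y)) ^ 2 = 4 * (u + x * y * conj v) * (v + x * y * conj u)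

theorem harm_lineMap (c p q x y : ℂ) (r : ℝ) :
    AffineMap.lineMap (harm c p q x) (harm c p q y) r = harm c p q (x + r * (y - x)) := by
  rw [AffineMap.lineMap_apply_module]
  simp only [harm, map_add, map_mul, map_sub, Complex.conj_ofReal, Complex.real_smul]
  push_cast
  ring

theorem mem_line_harm_iff {c p q x y : ℂ} (hpq : ‖q‖ < ‖p‖) (hx : ‖x‖ = 1) (hy : ‖y‖ = 1)
    (hxy : x ≠ y) (w : ℂ) :
    harm c p q w ∈ affineSpan ℝ {harm c p q x, harm c p q y} ↔
      w + x * y * conj w = x + y := by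
  rw [← mem_chord_iff hx hy hxy, mem_affineSpan_pair_iff_exists_lineMap_eq]
  simp only [harm_lineMap]
  exact exists_congr fun r => ⟨fun h => (harm_injective hpq h).symm, fun h => by rw [h]⟩

/-- Multiplied by `e`, the chord equation at the point of parameter `e` is a quadratic whose outer
coefficients have equal modulus; tangency is the vanishing of its discriminant. -/
theorem isTangentLine_iff {E : Ellipse} {c p q c' u v x y : ℂ} (hpq : ‖q‖ < ‖p‖)
    (huv : ‖v‖ < ‖u‖)
    (hE : E.curve = (fun e => harm c p q (harm c' u v e)) '' {e : ℂ | ‖e‖ = 1})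
    (hx : ‖x‖ = 1) (hy : ‖y‖ = 1) (hxy : x ≠ y) :
    E.IsTangentLine (affineSpan ℝ {harm c p q x, harm c p q y}) ↔ TangentChord c' u v x y := by
  have hP : ‖x * y‖ = 1 := by rw [norm_mul, hx, hy, one_mul]
  have hroot : ∀ e : ℂ, ‖e‖ = 1 →
      (harm c p q (harm c' u v e) ∈ affineSpan ℝ {harm c p q x, harm c p q y} ↔
        (u + x * y * conj v) * e ^ 2 + (c' + x * y * conj c' - (x + y)) * e
          + (v + x * y * conj u) = 0) := by
    intro e he
    have he' := mul_conj_of_norm_one he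
    have he0 : e ≠ 0 := by rintro rfl; simp at he
    rw [mem_line_harm_iff hpq hx hy hxy]
    simp only [harm, map_add, map_mul, Complex.conj_conj]
    constructor
    · intro h
      linear_combination e * h - (v + x * y * conj u) * he'
    · intro h
      apply mul_left_cancel₀ he0
      linear_combination h + (v + x * y * conj u) * he'
  have hinj : Function.Injective fun e => harm c p q (harm c' u v e) :=
    (harm_injective hpq).comp (harm_injective huv)
  rw [TangentChord, ← existsUnique_unit_root_iff (lead_ne_zero hP huv) (lead_norm_eq hP),
    Ellipse.IsTangentLine, hE]
  constructor
  · rintro ⟨z, ⟨hz, e, he, rfl⟩, huniq⟩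
    refine ⟨e, ⟨he, (hroot e he).mp hz⟩, ?_⟩
    rintro e' ⟨he', h'⟩
    exact hinj (huniq _ ⟨(hroot e' he').mpr h', e', he', rfl⟩)
  · rintro ⟨e, ⟨he, h⟩, huniq⟩
    refine ⟨_, ⟨(hroot e he).mpr h, e, he, rfl⟩, ?_⟩
    rintro _ ⟨hz, e', he', rfl⟩
    rw [huniq e' ⟨he', (hroot e' he').mp hz⟩]

/-! ### Poncelet triangles of the unit circle -/

/-- The symmetric biquadratic form whose zeros are the tangent chords. -/
def ponceletForm (s s' m m' K x y : ℂ) : ℂ :=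
  (x + y) ^ 2 + m + m' * (x * y) ^ 2 - s * (x + y) - s' * (x + y) * (x * y) + K * (x * y)

/-- The coefficients `2 * c` and `c ^ 2 - 4 * (u * v)` are the sum and the product of the foci of
the inner ellipse. -/
theorem tangentChord_iff (c u v x y : ℂ) : TangentChord c u v x y ↔
    ponceletForm (2 * c) (conj (2 * c)) (c ^ 2 - 4 * (u * v)) (conj (c ^ 2 - 4 * (u * v)))
      (2 * (c * conj c) - 4 * (u * conj u + v * conj v)) x y = 0 := by
  rw [TangentChord, ← sub_eq_zero, ponceletForm]
  simp only [map_sub, map_mul, map_pow, Complex.conj_ofNat]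
  constructor <;> intro h <;> linear_combination h

/-- Eliminating `K` between the two equations sharing a vertex shows that this vertex is a root of a
cubic whose coefficients depend only on `x * y * z`. All three vertices are its roots, so Vieta
gives the sum; substituting back gives `K`. -/
theorem vieta_of_ponceletForm {s s' m m' K x y z : ℂ} (hx : x ≠ 0) (hxy : x ≠ y) (hxz : x ≠ z)
    (hyz : y ≠ z) (h1 : ponceletForm s s' m m' K x y = 0)
    (h2 : ponceletForm s s' m m' K x z = 0) (h3 : ponceletForm s s' m m' K y z = 0) :
    x + y + z = s + x * y * z * m' ∧ K = s * s' - m * m' - 1 := by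
  have lin : ∀ x y z : ℂ, y ≠ z → ponceletForm s s' m m' K x y = 0 →
      ponceletForm s s' m m' K x z = 0 →
      (1 - s' * x + m' * x ^ 2) * (y + z) + (2 * x - s - s' * x ^ 2 + K * x) = 0 := by
    intro x y z hyz h1 h2
    apply mul_left_cancel₀ (sub_ne_zero.mpr hyz)
    rw [ponceletForm] at h1 h2
    linear_combination h1 - h2
  have cub : ∀ x y z : ℂ, y ≠ z → ponceletForm s s' m m' K x y = 0 →
      ponceletForm s s' m m' K x z = 0 →
      x ^ 3 - (s + x * y * z * m') * x ^ 2 + (m + x * y * z * s') * x - x * y * z = 0 := by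
    intro x y z hyz h1 h2
    have h := lin x y z hyz h1 h2
    rw [ponceletForm] at h1
    linear_combination x * h1 - x * y * h
  have symm : ∀ x y : ℂ, ponceletForm s s' m m' K x y = ponceletForm s s' m m' K y x := by
    intro x y; simp only [ponceletForm]; ring
  have c1 := cub x y z hyz h1 h2
  have c2 := cub y x z hxz (by rwa [symm]) h3
  have c3 := cub z x y hxy (by rwa [symm]) (by rwa [symm])
  have d1 : x ^ 2 + x * y + y ^ 2 - (s + x * y * z * m') * (x + y) + (m + x * y * z * s') = 0 := by
    apply mul_left_cancel₀ (sub_ne_zero.mpr hxy)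
    linear_combination c1 - c2
  have d2 : x ^ 2 + x * z + z ^ 2 - (s + x * y * z * m') * (x + z) + (m + x * y * z * s') = 0 := by
    apply mul_left_cancel₀ (sub_ne_zero.mpr hxz)
    linear_combination c1 - c3
  have hs : x + y + z = s + x * y * z * m' := by
    apply mul_left_cancel₀ (sub_ne_zero.mpr hyz)
    linear_combination d1 - d2
  refine ⟨hs, ?_⟩
  have h := lin x y z hyz h1 h2
  apply mul_left_cancel₀ hx
  linear_combination h - (1 - s' * x + m' * x ^ 2) * hs + m' * c1

theorem ponceletForm_eq_zero_of_vieta {s s' m m' K x y z : ℂ} (hz : z ≠ 0)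
    (h1 : x + y + z = s + x * y * z * m') (h2 : x * y + x * z + y * z = m + x * y * z * s')
    (hK : K = s * s' - m * m' - 1) : ponceletForm s s' m m' K x y = 0 := by
  apply mul_left_cancel₀ hz
  rw [ponceletForm, hK]
  linear_combination (-(x * y) + m) * h1 + (x + y - s) * h2

theorem blaschke_identity (f w : ℂ) :
    ‖1 - conj f * w‖ ^ 2 - ‖w - f‖ ^ 2 = (1 - ‖w‖ ^ 2) * (1 - ‖f‖ ^ 2) := by
  simp only [← Complex.normSq_eq_norm_sq, Complex.normSq_apply, Complex.sub_re, Complex.sub_im,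
    Complex.mul_re, Complex.mul_im, Complex.conj_re, Complex.conj_im, Complex.one_re,
    Complex.one_im]
  ring

/-- A Blaschke product with zeros `0, f, g` has modulus below one inside the disc and above one
outside. The cross-multiplied form avoids its poles. -/
theorem norm_eq_one_of_blaschke {f g w l : ℂ} (hf : ‖f‖ < 1) (hg : ‖g‖ < 1) (hl : ‖l‖ = 1)
    (h : w * ((w - f) * (w - g)) = l * ((1 - conj f * w) * (1 - conj g * w))) : ‖w‖ = 1 := by
  have hn : ‖w‖ * (‖w - f‖ * ‖w - g‖) = ‖1 - conj f * w‖ * ‖1 - conj g * w‖ := by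
    simpa only [norm_mul, hl, one_mul] using congrArg norm h
  have h1 := blaschke_identity f w
  have h2 := blaschke_identity g w
  have hf' : 0 < 1 - ‖f‖ ^ 2 := by nlinarith [norm_nonneg f]
  have hg' : 0 < 1 - ‖g‖ ^ 2 := by nlinarith [norm_nonneg g]
  rcases lt_trichotomy ‖w‖ 1 with hw | hw | hw
  · exfalso
    have hw' : 0 < 1 - ‖w‖ ^ 2 := by nlinarith [norm_nonneg w]
    have a1 : ‖w - f‖ < ‖1 - conj f * w‖ :=
      lt_of_pow_lt_pow_left₀ 2 (norm_nonneg _) (by nlinarith [mul_pos hw' hf'])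
    have a2 : ‖w - g‖ < ‖1 - conj g * w‖ :=
      lt_of_pow_lt_pow_left₀ 2 (norm_nonneg _) (by nlinarith [mul_pos hw' hg'])
    have a3 := mul_lt_mul'' a1 a2 (norm_nonneg _) (norm_nonneg _)
    have a4 : ‖w‖ * (‖w - f‖ * ‖w - g‖) ≤ 1 * (‖w - f‖ * ‖w - g‖) :=
      mul_le_mul_of_nonneg_right hw.le (by positivity)
    linarith
  · exact hw
  · exfalso
    have hw' : 0 < ‖w‖ ^ 2 - 1 := by nlinarith
    have a1 : ‖1 - conj f * w‖ < ‖w - f‖ :=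
      lt_of_pow_lt_pow_left₀ 2 (norm_nonneg _) (by nlinarith [mul_pos hw' hf'])
    have a2 : ‖1 - conj g * w‖ < ‖w - g‖ :=
      lt_of_pow_lt_pow_left₀ 2 (norm_nonneg _) (by nlinarith [mul_pos hw' hg'])
    have a3 := mul_lt_mul'' a1 a2 (norm_nonneg _) (norm_nonneg _)
    have a4 : 1 * (‖w - f‖ * ‖w - g‖) ≤ ‖w‖ * (‖w - f‖ * ‖w - g‖) :=
      mul_le_mul_of_nonneg_right hw.le (by positivity)
    linarith

/-- The equation `w (w - f) (w - g) = l (1 - f̄ w) (1 - ḡ w)` has no double root on the unit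
circle. -/
theorem blaschke_deriv_ne_zero {f g w l : ℂ} (hf : ‖f‖ < 1) (hg : ‖g‖ < 1) (hw : ‖w‖ = 1)
    (h : w * ((w - f) * (w - g)) = l * ((1 - conj f * w) * (1 - conj g * w)))
    (h' : (w - f) * (w - g) + w * ((w - f) + (w - g)) =
      l * (-conj f * (1 - conj g * w) - conj g * (1 - conj f * w))) : False := by
  have hww := mul_conj_of_norm_one hw
  have hw0 : w ≠ 0 := by rintro rfl; simp at hw
  have hf0 : w - f ≠ 0 := sub_ne_zero.mpr (by rintro rfl; exact hf.ne hw)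
  have hg0 : w - g ≠ 0 := sub_ne_zero.mpr (by rintro rfl; exact hg.ne hw)
  have ef : 1 - conj f * w = w * conj (w - f) := by
    rw [map_sub]; linear_combination -hww
  have eg : 1 - conj g * w = w * conj (w - g) := by
    rw [map_sub]; linear_combination -hww
  rw [ef, eg] at h h'
  set F := w - f with hF
  set G := w - g with hG
  have hFf : w * conj F + conj f * w = 1 := by rw [← ef]; ring
  have hGg : w * conj G + conj g * w = 1 := by rw [← eg]; ring
  have h1 : F * G = l * w * (conj F * conj G) := by
    apply mul_left_cancel₀ hw0
    linear_combination h
  -- Up to the factor `‖F‖² ‖G‖²`, the left side is the logarithmic derivative `w B'/B = 1 + (1 -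
  -- ‖f‖²)/‖F‖² + (1 - ‖g‖²)/‖G‖²` of the Blaschke product `B`, which is positive on the circle.
  have h2 : F * conj F * (G * conj G) + G * conj G * (w * conj F + conj f * F)
      + F * conj F * (w * conj G + conj g * G) = 0 := by
    linear_combination conj F * conj G * h' + (conj f * conj G + conj g * conj F) * h1
  have e1 : w * conj F + conj f * F = ((1 - ‖f‖ ^ 2 : ℝ) : ℂ) := by
    push_cast
    rw [← Complex.mul_conj' f]
    linear_combination hFf + conj f * hF
  have e2 : w * conj G + conj g * G = ((1 - ‖g‖ ^ 2 : ℝ) : ℂ) := by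
    push_cast
    rw [← Complex.mul_conj' g]
    linear_combination hGg + conj g * hG
  rw [e1, e2, Complex.mul_conj', Complex.mul_conj'] at h2
  have h3 : ‖F‖ ^ 2 * ‖G‖ ^ 2 + ‖G‖ ^ 2 * (1 - ‖f‖ ^ 2) + ‖F‖ ^ 2 * (1 - ‖g‖ ^ 2) = 0 := by
    exact_mod_cast h2
  have hf' : 0 < 1 - ‖f‖ ^ 2 := by nlinarith [norm_nonneg f]
  have hg' : 0 < 1 - ‖g‖ ^ 2 := by nlinarith [norm_nonneg g]
  have p1 : 0 < ‖F‖ := norm_pos_iff.mpr hf0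
  have p2 : 0 < ‖G‖ := norm_pos_iff.mpr hg0
  have : 0 < ‖F‖ ^ 2 * ‖G‖ ^ 2 + ‖G‖ ^ 2 * (1 - ‖f‖ ^ 2) + ‖F‖ ^ 2 * (1 - ‖g‖ ^ 2) := by
    positivity
  exact this.ne' h3

theorem exists_cubic_roots (b c d : ℂ) : ∃ x y z : ℂ,
    x + y + z = -b ∧ x * y + x * z + y * z = c ∧ x * y * z = -d := by
  let P : Cubic ℂ := ⟨1, b, c, d⟩
  have ha : P.a ≠ 0 := one_ne_zero
  obtain ⟨x, y, z, h⟩ := (Cubic.splits_iff_roots_eq_three (φ := RingHom.id ℂ) ha).mp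
    (IsAlgClosed.splits _)
  have hb := Cubic.b_eq_three_roots ha h
  have hc := Cubic.c_eq_three_roots ha h
  have hd := Cubic.d_eq_three_roots ha h
  simp only [P, RingHom.id_apply, one_mul] at hb hc hd
  exact ⟨x, y, z, by rw [hb, neg_neg], hc.symm, by rw [hd, neg_neg]⟩

theorem exists_blaschke_triple {f g l : ℂ} (hf : ‖f‖ < 1) (hg : ‖g‖ < 1) (hl : ‖l‖ = 1) :
    ∃ x y z : ℂ, ‖x‖ = 1 ∧ ‖y‖ = 1 ∧ ‖z‖ = 1 ∧ x ≠ y ∧ x ≠ z ∧ y ≠ z ∧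
      x * y * z = l ∧ x + y + z = f + g + l * conj (f * g) ∧
      x * y + x * z + y * z = f * g + l * conj (f + g) := by
  obtain ⟨x, y, z, h1, h2, h3⟩ := exists_cubic_roots (-(f + g + l * conj (f * g)))
    (f * g + l * conj (f + g)) (-l)
  rw [neg_neg] at h1 h3
  rw [map_mul] at h1
  rw [map_add] at h2
  have root : ∀ w, (w - x) * (w - y) * (w - z) =
      w * ((w - f) * (w - g)) - l * ((1 - conj f * w) * (1 - conj g * w)) := by
    intro w
    linear_combination -w ^ 2 * h1 + w * h2 - h3
  have unit : ∀ w, (w - x) * (w - y) * (w - z) = 0 → ‖w‖ = 1 := by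
    intro w hw
    rw [root, sub_eq_zero] at hw
    exact norm_eq_one_of_blaschke hf hg hl hw
  have nodouble : ∀ w, (w - x) * (w - y) * (w - z) = 0 →
      (w - x) * (w - y) + (w - x) * (w - z) + (w - y) * (w - z) = 0 → False := by
    intro w hw hw'
    have hu := unit w hw
    rw [root, sub_eq_zero] at hw
    refine blaschke_deriv_ne_zero hf hg hu hw ?_
    linear_combination hw' + 2 * w * h1 - h2
  refine ⟨x, y, z, unit x (by ring), unit y (by ring), unit z (by ring), ?_, ?_, ?_, h3,
    by rw [map_mul, h1], by rw [map_add, h2]⟩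
  · rintro rfl; exact nodouble x (by ring) (by ring)
  · rintro rfl; exact nodouble x (by ring) (by ring)
  · rintro rfl; exact nodouble y (by ring) (by ring)

/-- The foci of an ellipse lying in the unit disc lie in the unit disc. -/
theorem exists_foci {c u v : ℂ} (hu : u ≠ 0) (h : ∀ e : ℂ, ‖e‖ = 1 → ‖harm c u v e‖ < 1) :
    ∃ f g : ℂ, ‖f‖ < 1 ∧ ‖g‖ < 1 ∧ f + g = 2 * c ∧ f * g = c ^ 2 - 4 * (u * v) := by
  -- The foci are `c ± r (u e + v ē)` with `e` the parameter of a major vertex and `r` the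
  -- eccentricity, hence convex combinations of two antipodal points of the ellipse.
  suffices H : ∃ (e : ℂ) (r : ℝ), ‖e‖ = 1 ∧ 0 ≤ r ∧ r ≤ 1 ∧
      (r * (u * e + v * conj e)) ^ 2 = 4 * (u * v) by
    obtain ⟨e, r, he, hr0, hr1, hd⟩ := H
    have hb1 : harm c u v e ∈ Metric.ball (0 : ℂ) 1 := by simpa using h e he
    have hb2 : harm c u v (-e) ∈ Metric.ball (0 : ℂ) 1 := by
      simpa using h (-e) (by rwa [norm_neg])
    have hconv : ∀ t : ℝ, 0 ≤ t → t ≤ 1 →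
        ‖t * harm c u v e + (1 - t : ℝ) * harm c u v (-e)‖ < 1 := by
      intro t ht0 ht1
      have := (convex_ball (0 : ℂ) 1) hb1 hb2 ht0 (sub_nonneg.mpr ht1) (by ring)
      simpa using this
    refine ⟨c + r * (u * e + v * conj e), c - r * (u * e + v * conj e), ?_, ?_, by ring, by
      linear_combination -hd⟩
    · convert hconv ((1 + r) / 2) (by linarith) (by linarith) using 2
      simp only [harm, map_neg]; push_cast; ring
    · convert hconv ((1 - r) / 2) (by linarith) (by linarith) using 2
      simp only [harm, map_neg]; push_cast; ring
  by_cases hv : v = 0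
  · exact ⟨1, 0, by simp, le_rfl, zero_le_one, by simp [hv]⟩
  have hu' : 0 < ‖u‖ := norm_pos_iff.mpr hu
  have hv' : 0 < ‖v‖ := norm_pos_iff.mpr hv
  obtain ⟨μ, hμ⟩ := exists_unit_mul_norm u
  obtain ⟨ν, hν⟩ := exists_unit_mul_norm v
  set k := Complex.exp (((ν - μ) / 2 : ℝ) * Complex.I) with hk
  set g := Complex.exp (((μ + ν) / 2 : ℝ) * Complex.I) with hg
  have hk1 : ‖k‖ = 1 := Complex.norm_exp_ofReal_mul_I _
  have hkc := mul_conj_of_norm_one hk1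
  have e1 : u = ‖u‖ * (g * conj k) := by
    rw [hg, hk, conj_exp_mul_I, ← Complex.exp_add]
    conv_lhs => rw [hμ]
    congr 2; push_cast; ring
  have e2 : v = ‖v‖ * (g * k) := by
    rw [hg, hk, ← Complex.exp_add]
    conv_lhs => rw [hν]
    congr 2; push_cast; ring
  set a := Real.sqrt ‖u‖
  set b := Real.sqrt ‖v‖
  have ha : ‖u‖ = a ^ 2 := (Real.sq_sqrt hu'.le).symm
  have hb : ‖v‖ = b ^ 2 := (Real.sq_sqrt hv'.le).symm
  have ha0 : 0 < a := Real.sqrt_pos.mpr hu'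
  have hb0 : 0 < b := Real.sqrt_pos.mpr hv'
  -- The choice of `k` aligns `u * k` with `v * conj k`, so the semi-axes are `a² ± b²` and the
  -- focal distance from the centre is `2 a b`.
  refine ⟨k, 2 * (a * b) / (a ^ 2 + b ^ 2), hk1, by positivity, ?_, ?_⟩
  · rw [div_le_one (by positivity)]
    nlinarith [sq_nonneg (a - b)]
  · have hab : ((a : ℂ) ^ 2 + (b : ℂ) ^ 2) ≠ 0 := by
      have : a ^ 2 + b ^ 2 ≠ 0 := by positivity
      exact_mod_cast this
    have e3 : u * k + v * conj k = ((a : ℂ) ^ 2 + (b : ℂ) ^ 2) * g := by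
      rw [ha] at e1; rw [hb] at e2
      push_cast at e1 e2
      linear_combination k * e1 + conj k * e2 + ((a : ℂ) ^ 2 + (b : ℂ) ^ 2) * g * hkc
    have e4 : u * v = ((a : ℂ) * b * g) ^ 2 := by
      rw [ha] at e1; rw [hb] at e2
      push_cast at e1 e2
      rw [e1, e2]
      linear_combination ((a : ℂ) * b * g) ^ 2 * hkc
    rw [e3, e4]
    push_cast
    field_simp
    ring

/-! ### Centers of the triangles inscribed in an ellipse -/

theorem centroid_triangle (T : Affine.Triangle ℝ ℂ) :
    T.centroid = (T.points 0 + T.points 1 + T.points 2) / 3 := by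
  rw [Affine.Simplex.centroid_eq_affineCombination,
    Finset.affineCombination_eq_linear_combination _ _ _
      (Finset.sum_centroidWeights_eq_one_of_nonempty _ _ Finset.univ_nonempty),
    Fin.sum_univ_three]
  simp only [Finset.centroidWeights_apply, Complex.real_smul]
  simp
  ring

/-- The circumcenter, relative to the centre of the ellipse, of the triangle whose normalised
vertices have first and third elementary symmetric functions `σ` and `l`. -/
noncomputable def circumOffset (p q σ l : ℂ) : ℂ :=
  (p * (conj p * q * conj σ + p * conj q * l) - q * (p * conj q * σ + conj p * q * conj l)) /
    (p * conj p - q * conj q)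

theorem mul_conj_sub_ne_zero {p q : ℂ} (h : ‖q‖ < ‖p‖) : p * conj p - q * conj q ≠ 0 := by
  rw [Complex.mul_conj', Complex.mul_conj']
  have : ‖p‖ ^ 2 - ‖q‖ ^ 2 ≠ 0 := by
    have := pow_lt_pow_left₀ h (norm_nonneg _) two_ne_zero
    linarith
  exact_mod_cast this

theorem circumOffset_spec {p q : ℂ} (h : ‖q‖ < ‖p‖) (σ l : ℂ) :
    p * conj (circumOffset p q σ l) + conj q * circumOffset p q σ l =
      p * conj q * σ + conj p * q * conj l := by
  have h0 := mul_conj_sub_ne_zero h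
  simp only [circumOffset, map_div₀, map_sub, map_add, map_mul, Complex.conj_conj]
  rw [mul_comm (conj p) p, mul_comm (conj q) q, ← mul_div_assoc, ← mul_div_assoc, ← add_div,
    div_eq_iff h0]
  ring

/-- Reducing `w²` by the cubic that `w` satisfies leaves only terms in `w` and `w̄`; `ho` is exactly
the condition that they cancel, so the distance does not depend on the vertex. -/
theorem dist_sq_harm {c p q o w : ℂ} (hw : ‖w‖ = 1) {σ l τ : ℂ}
    (ho : p * conj o + conj q * o = p * conj q * σ + conj p * q * conj l)
    (hr : w ^ 2 - σ * w + τ - l * conj w = 0) :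
    ((dist (harm c p q w) (c + o) ^ 2 : ℝ) : ℂ) =
      p * conj p + q * conj q + o * conj o - p * conj q * τ - conj p * q * conj τ := by
  have hw' := mul_conj_of_norm_one hw
  have ho' := congrArg conj ho
  have hr' := congrArg conj hr
  simp only [map_add, map_sub, map_mul, map_pow, map_zero, Complex.conj_conj] at ho' hr'
  rw [dist_eq_norm]
  push_cast
  rw [← Complex.mul_conj']
  simp only [harm, map_add, map_sub, map_mul, Complex.conj_conj]
  linear_combination (p * conj p + q * conj q) * hw' - w * ho - conj w * ho'
    + p * conj q * hr + conj p * q * hr'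

theorem circumcenter_of_harm {c p q : ℂ} (hpq : ‖q‖ < ‖p‖) (T : Affine.Triangle ℝ ℂ)
    {x y z : ℂ} (hx : ‖x‖ = 1) (hy : ‖y‖ = 1) (hz : ‖z‖ = 1)
    (h0 : T.points 0 = harm c p q x) (h1 : T.points 1 = harm c p q y)
    (h2 : T.points 2 = harm c p q z) :
    T.circumcenter = c + circumOffset p q (x + y + z) (x * y * z) := by
  have hx' := mul_conj_of_norm_one hx
  have hy' := mul_conj_of_norm_one hy
  have hz' := mul_conj_of_norm_one hz
  set o := circumOffset p q (x + y + z) (x * y * z) with ho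
  have spec := circumOffset_spec hpq (x + y + z) (x * y * z)
  rw [← ho] at spec
  have d0 := dist_sq_harm (c := c) (τ := x * y + x * z + y * z) hx spec
    (by linear_combination -y * z * hx')
  have d1 := dist_sq_harm (c := c) (τ := x * y + x * z + y * z) hy spec
    (by linear_combination -x * z * hy')
  have d2 := dist_sq_harm (c := c) (τ := x * y + x * z + y * z) hz spec
    (by linear_combination -x * y * hz')
  have e1 : dist (T.points 1) (c + o) = dist (T.points 0) (c + o) := by
    rw [h0, h1, ← sq_eq_sq₀ dist_nonneg dist_nonneg]
    exact_mod_cast d1.trans d0.symm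
  have e2 : dist (T.points 2) (c + o) = dist (T.points 0) (c + o) := by
    rw [h0, h2, ← sq_eq_sq₀ dist_nonneg dist_nonneg]
    exact_mod_cast d2.trans d0.symm
  symm
  refine T.eq_circumcenter_of_dist_eq (r := dist (T.points 0) (c + o)) ?_ ?_
  · rw [T.independent.affineSpan_eq_top_iff_card_eq_finrank_add_one.mpr (by simp)]
    trivial
  · intro i
    fin_cases i
    · rfl
    · exact e1
    · exact e2

theorem exists_triangle_harm {c p q : ℂ} (hpq : ‖q‖ < ‖p‖) {x y z : ℂ} (hx : ‖x‖ = 1)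
    (hy : ‖y‖ = 1) (hz : ‖z‖ = 1) (hxy : x ≠ y) (hxz : x ≠ z) (hyz : y ≠ z) :
    ∃ T : Affine.Triangle ℝ ℂ, T.points = ![harm c p q x, harm c p q y, harm c p q z] := by
  refine ⟨⟨_, affineIndependent_of_ne_of_mem_of_mem_of_notMem
    (s := affineSpan ℝ {harm c p q x, harm c p q y}) ((harm_injective hpq).ne hxy)
    (left_mem_affineSpan_pair _ _ _) (right_mem_affineSpan_pair _ _ _) ?_⟩, rfl⟩
  rw [mem_line_harm_iff hpq hx hy hxy]
  intro h
  have hz' := mul_conj_of_norm_one hz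
  have h0 : (z - x) * (z - y) = 0 := by linear_combination z * h - x * y * hz'
  rcases mul_eq_zero.mp h0 with h0 | h0
  · exact hxz (sub_eq_zero.mp h0).symm
  · exact hyz (sub_eq_zero.mp h0).symm

/-! ### Normalisation of the pair -/

/-- The new map is the inverse of the outer map composed with the inner one. The quantity `‖u‖² -
‖v‖²` is its determinant, so positivity is inherited. -/
theorem exists_harm_comp {c p q C U V : ℂ} (hpq : ‖q‖ < ‖p‖) (hUV : ‖V‖ < ‖U‖) :
    ∃ c' u v : ℂ, ‖v‖ < ‖u‖ ∧ ∀ e, harm c p q (harm c' u v e) = harm C U V e := by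
  have h0 := mul_conj_sub_ne_zero hpq
  set D := p * conj p - q * conj q with hD
  have hDc : conj D = D := by simp only [hD, map_sub, map_mul, Complex.conj_conj]; ring
  refine ⟨(conj p * (C - c) - q * conj (C - c)) / D, (conj p * U - q * conj V) / D,
    (conj p * V - q * conj U) / D, ?_, ?_⟩
  · rw [norm_div, norm_div]
    refine div_lt_div_of_pos_right ?_ (norm_pos_iff.mpr h0)
    apply lt_of_pow_lt_pow_left₀ 2 (norm_nonneg _)
    have key : ‖conj p * U - q * conj V‖ ^ 2 - ‖conj p * V - q * conj U‖ ^ 2 =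
        (‖p‖ ^ 2 - ‖q‖ ^ 2) * (‖U‖ ^ 2 - ‖V‖ ^ 2) := by
      simp only [← Complex.normSq_eq_norm_sq, Complex.normSq_apply, Complex.sub_re,
        Complex.sub_im, Complex.mul_re, Complex.mul_im, Complex.conj_re, Complex.conj_im]
      ring
    have h1 := pow_lt_pow_left₀ hpq (norm_nonneg _) two_ne_zero
    have h2 := pow_lt_pow_left₀ hUV (norm_nonneg _) two_ne_zero
    nlinarith [mul_pos (sub_pos.mpr h1) (sub_pos.mpr h2)]
  · intro e
    simp only [harm, map_add, map_sub, map_mul, map_div₀, Complex.conj_conj, hDc]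
    field_simp
    rw [hD]
    ring

namespace Ellipse

/-- The two coefficients of the parametrization `e ↦ center + p e + q ē` of an ellipse. -/
noncomputable def coeffP (E : Ellipse) : ℂ := Complex.exp (E.θ * Complex.I) * ((E.a + E.b) / 2)

/-- See `coeffP`. -/
noncomputable def coeffQ (E : Ellipse) : ℂ := Complex.exp (E.θ * Complex.I) * ((E.a - E.b) / 2)

theorem curve_eq_image (E : Ellipse) :
    E.curve = harm E.center E.coeffP E.coeffQ '' {e : ℂ | ‖e‖ = 1} :=
  ellipseCurve_eq_image _ _ _ _

theorem norm_coeffP (E : Ellipse) : ‖E.coeffP‖ = (E.a + E.b) / 2 := by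
  have h : ((E.a : ℂ) + E.b) / 2 = ((E.a + E.b) / 2 : ℝ) := by push_cast; rfl
  rw [coeffP, norm_mul, Complex.norm_exp_ofReal_mul_I, one_mul, h, Complex.norm_real,
    Real.norm_of_nonneg (by linarith [E.b_pos, E.b_le_a])]

theorem norm_coeffQ (E : Ellipse) : ‖E.coeffQ‖ = (E.a - E.b) / 2 := by
  have h : ((E.a : ℂ) - E.b) / 2 = ((E.a - E.b) / 2 : ℝ) := by push_cast; rfl
  rw [coeffQ, norm_mul, Complex.norm_exp_ofReal_mul_I, one_mul, h, Complex.norm_real,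
    Real.norm_of_nonneg (by linarith [E.b_le_a])]

theorem norm_coeffQ_lt (E : Ellipse) : ‖E.coeffQ‖ < ‖E.coeffP‖ := by
  rw [norm_coeffP, norm_coeffQ]; linarith [E.b_pos]

theorem harm_mem_inside_iff (E : Ellipse) (w : ℂ) :
    harm E.center E.coeffP E.coeffQ w ∈ E.inside ↔ ‖w‖ < 1 := by
  have ha : E.a ≠ 0 := (E.b_pos.trans_le E.b_le_a).ne'
  have hb : E.b ≠ 0 := E.b_pos.ne'
  have h : Complex.exp (-(E.θ * Complex.I)) *
      (harm E.center E.coeffP E.coeffQ w - E.center) =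
      ((E.a + E.b) / 2 : ℝ) * w + ((E.a - E.b) / 2 : ℝ) * conj w := by
    have he : Complex.exp (-(E.θ * Complex.I)) * Complex.exp (E.θ * Complex.I) = 1 := by
      rw [← Complex.exp_add]; simp
    simp only [harm, coeffP, coeffQ]
    push_cast
    linear_combination ((E.a + E.b) / 2 * w + (E.a - E.b) / 2 * conj w) * he
  have hre : ((E.a + E.b) / 2 * w.re + (E.a - E.b) / 2 * w.re) / E.a = w.re := by
    field_simp; ring
  have him : ((E.a + E.b) / 2 * w.im + -((E.a - E.b) / 2 * w.im)) / E.b = w.im := by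
    field_simp; ring
  rw [inside, Set.mem_ofPred_eq, h]
  simp only [Complex.add_re, Complex.add_im, Complex.re_ofReal_mul, Complex.im_ofReal_mul,
    Complex.conj_re, Complex.conj_im, mul_neg, hre, him]
  rw [← sq_lt_one_iff₀ (norm_nonneg w), ← Complex.normSq_eq_norm_sq, Complex.normSq_apply, sq, sq]

end Ellipse

/-! ### The porism. -/

theorem foci_product_norm_lt {f g : ℂ} (hf : ‖f‖ < 1) (hg : ‖g‖ < 1) : ‖f * g‖ < 1 := by
  rw [norm_mul]
  exact mul_lt_one_of_nonneg_of_lt_one_left (norm_nonneg _) hf hg.le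

/-- The porism: the 3-periodics of a nested pair, in normalised coordinates, are parametrized by
the unit circle through the product `l` of their vertices, and their vertex sum is affine in
`l`. -/
theorem exists_porism_param (E Ec : Ellipse) (hnested : Ec.curve ⊆ E.inside)
    (hporistic : ∃ T : Affine.Triangle ℝ ℂ, IsThreePeriodic E Ec T) :
    ∃ s m : ℂ, ‖m‖ < 1 ∧
      (∀ T, IsThreePeriodic E Ec T → ∃ x y z : ℂ, ‖x‖ = 1 ∧ ‖y‖ = 1 ∧ ‖z‖ = 1 ∧
        T.points = ![harm E.center E.coeffP E.coeffQ x, harm E.center E.coeffP E.coeffQ y,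
          harm E.center E.coeffP E.coeffQ z] ∧ x + y + z = s + x * y * z * conj m) ∧
      (∀ l : ℂ, ‖l‖ = 1 → ∃ T, IsThreePeriodic E Ec T ∧ ∃ x y z : ℂ,
        ‖x‖ = 1 ∧ ‖y‖ = 1 ∧ ‖z‖ = 1 ∧ x * y * z = l ∧
        T.points = ![harm E.center E.coeffP E.coeffQ x, harm E.center E.coeffP E.coeffQ y,
          harm E.center E.coeffP E.coeffQ z] ∧ x + y + z = s + x * y * z * conj m) := by
  have hpq := E.norm_coeffQ_lt
  obtain ⟨c, u, v, huv, hcomp⟩ :=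
    exists_harm_comp (c := E.center) (C := Ec.center) hpq Ec.norm_coeffQ_lt
  have hEc : Ec.curve = (fun e => harm E.center E.coeffP E.coeffQ (harm c u v e)) ''
      {e : ℂ | ‖e‖ = 1} := by
    rw [Ec.curve_eq_image]
    exact Set.image_congr fun e _ => (hcomp e).symm
  have hdisc : ∀ e : ℂ, ‖e‖ = 1 → ‖harm c u v e‖ < 1 := by
    intro e he
    rw [← E.harm_mem_inside_iff]
    exact hnested (hEc ▸ ⟨e, he, rfl⟩)
  have hu : u ≠ 0 := by
    rintro rfl
    rw [norm_zero] at huv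
    exact huv.not_ge (norm_nonneg _)
  obtain ⟨f, g, hf, hg, hs, hm⟩ := exists_foci hu hdisc
  set K := 2 * (c * conj c) - 4 * (u * conj u + v * conj v) with hK
  have htan : ∀ {x y : ℂ}, ‖x‖ = 1 → ‖y‖ = 1 → x ≠ y →
      (Ec.IsTangentLine (affineSpan ℝ {harm E.center E.coeffP E.coeffQ x,
        harm E.center E.coeffP E.coeffQ y}) ↔
        ponceletForm (f + g) (conj (f + g)) (f * g) (conj (f * g)) K x y = 0) := by
    intro x y hx hy hxy
    rw [isTangentLine_iff hpq huv hEc hx hy hxy, tangentChord_iff, hs, hm]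
  have hperiodic : ∀ T, IsThreePeriodic E Ec T → ∃ x y z : ℂ, ‖x‖ = 1 ∧ ‖y‖ = 1 ∧ ‖z‖ = 1 ∧
        T.points = ![harm E.center E.coeffP E.coeffQ x, harm E.center E.coeffP E.coeffQ y,
          harm E.center E.coeffP E.coeffQ z] ∧
        x + y + z = f + g + x * y * z * conj (f * g) ∧
        K = (f + g) * conj (f + g) - f * g * conj (f * g) - 1 := by
    rintro T ⟨hT, hl⟩
    rw [E.curve_eq_image] at hT
    obtain ⟨x, hx, h0⟩ := hT 0
    obtain ⟨y, hy, h1⟩ := hT 1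
    obtain ⟨z, hz, h2⟩ := hT 2
    have hne : ∀ {i j : Fin 3}, i ≠ j → T.points i ≠ T.points j := T.independent.injective.ne
    have hxy : x ≠ y := by
      rintro rfl; exact hne (i := 0) (j := 1) (by decide) (h0.symm.trans h1)
    have hxz : x ≠ z := by
      rintro rfl; exact hne (i := 0) (j := 2) (by decide) (h0.symm.trans h2)
    have hyz : y ≠ z := by
      rintro rfl; exact hne (i := 1) (j := 2) (by decide) (h1.symm.trans h2)
    have t01 := hl 0 1 (by decide)
    have t02 := hl 0 2 (by decide)
    have t12 := hl 1 2 (by decide)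
    rw [← h0, ← h1, htan hx hy hxy] at t01
    rw [← h0, ← h2, htan hx hz hxz] at t02
    rw [← h1, ← h2, htan hy hz hyz] at t12
    have hx0 : x ≠ 0 := by rintro rfl; simp at hx
    refine ⟨x, y, z, hx, hy, hz, ?_, vieta_of_ponceletForm hx0 hxy hxz hyz t01 t02 t12⟩
    ext i
    fin_cases i
    · exact h0.symm
    · exact h1.symm
    · exact h2.symm
  -- The closure condition on `K` involves only the pair, so one 3-periodic supplies it for every
  -- `l`.
  obtain ⟨T₀, hT₀⟩ := hporistic
  obtain ⟨-, -, -, -, -, -, -, -, hclose⟩ := hperiodic T₀ hT₀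
  refine ⟨f + g, f * g, foci_product_norm_lt hf hg, fun T hT => ?_, fun l hl => ?_⟩
  · obtain ⟨x, y, z, hx, hy, hz, hp, hsum, -⟩ := hperiodic T hT
    exact ⟨x, y, z, hx, hy, hz, hp, hsum⟩
  · obtain ⟨x, y, z, hx, hy, hz, hxy, hxz, hyz, h3, h1, h2⟩ := exists_blaschke_triple hf hg hl
    obtain ⟨T, hT⟩ := exists_triangle_harm (c := E.center) hpq hx hy hz hxy hxz hyz
    rw [← h3] at h1 h2
    have hne : ∀ {w : ℂ}, ‖w‖ = 1 → w ≠ 0 := by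
      rintro w hw rfl; simp at hw
    have txy := (htan hx hy hxy).mpr (ponceletForm_eq_zero_of_vieta (hne hz) h1 h2 hclose)
    have txz := (htan hx hz hxz).mpr (ponceletForm_eq_zero_of_vieta (z := y) (hne hy)
      (by linear_combination h1) (by linear_combination h2) hclose)
    have tyz := (htan hy hz hyz).mpr (ponceletForm_eq_zero_of_vieta (z := x) (hne hx)
      (by linear_combination h1) (by linear_combination h2) hclose)
    refine ⟨T, ⟨?_, ?_⟩, x, y, z, hx, hy, hz, h3, hT, h1⟩
    · intro i
      rw [hT, E.curve_eq_image]
      fin_cases i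
      · exact ⟨x, hx, rfl⟩
      · exact ⟨y, hy, rfl⟩
      · exact ⟨z, hz, rfl⟩
    · intro i j hij
      rw [hT]
      fin_cases i <;> fin_cases j
      · exact absurd rfl hij
      · exact txy
      · exact txz
      · rw [Set.pair_comm]; exact txy
      · exact absurd rfl hij
      · exact tyz
      · rw [Set.pair_comm]; exact txz
      · rw [Set.pair_comm]; exact tyz
      · exact absurd rfl hij

/-! ### The locus and its Hermitian form. -/

theorem circumOffset_affine (p q s m l : ℂ) :
    circumOffset p q (s + l * conj m) l =
      harm (circumOffset p q s 0) (p * conj q * (p - q * conj m) / (p * conj p - q * conj q))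
        (conj p * q * (p * m - q) / (p * conj p - q * conj q)) l := by
  simp only [circumOffset, harm, map_add, map_mul, Complex.conj_conj, map_zero]
  ring

theorem centerLocus_eq_image (E Ec : Ellipse) (hnested : Ec.curve ⊆ E.inside)
    (hporistic : ∃ T : Affine.Triangle ℝ ℂ, IsThreePeriodic E Ec T) :
    ∃ m c₂ c₃ : ℂ, ‖m‖ < 1 ∧ ∀ α β : ℂ, centerLocus E Ec α β =
      harm (α * c₂ + β * c₃)
        (α * (E.coeffP * conj m / 3) + β * (E.coeffP * conj E.coeffQ *
          (E.coeffP - E.coeffQ * conj m) / (E.coeffP * conj E.coeffP - E.coeffQ * conj E.coeffQ)))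
        (α * (E.coeffQ * m / 3) + β * (conj E.coeffP * E.coeffQ *
          (E.coeffP * m - E.coeffQ) / (E.coeffP * conj E.coeffP - E.coeffQ * conj E.coeffQ))) ''
        {e : ℂ | ‖e‖ = 1} := by
  obtain ⟨s, m, hm, hT, hl⟩ := exists_porism_param E Ec hnested hporistic
  set p := E.coeffP
  set q := E.coeffQ
  have centers : ∀ (α β : ℂ) (T : Affine.Triangle ℝ ℂ) (x y z : ℂ),
      ‖x‖ = 1 → ‖y‖ = 1 → ‖z‖ = 1 →
      T.points = ![harm E.center p q x, harm E.center p q y, harm E.center p q z] →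
      x + y + z = s + x * y * z * conj m →
      α * T.centroid + β * T.circumcenter =
        harm (α * (harm E.center p q (s / 3)) + β * (E.center + circumOffset p q s 0))
        (α * (p * conj m / 3) + β * (p * conj q * (p - q * conj m) / (p * conj p - q * conj q)))
        (α * (q * m / 3) + β * (conj p * q * (p * m - q) / (p * conj p - q * conj q)))
        (x * y * z) := by
    intro α β T x y z hx hy hz hp hsum
    have h0 : T.points 0 = harm E.center p q x := by rw [hp]; rfl
    have h1 : T.points 1 = harm E.center p q y := by rw [hp]; rfl
    have h2 : T.points 2 = harm E.center p q z := by rw [hp]; rfl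
    have hsum' := congrArg conj hsum
    rw [circumcenter_of_harm E.norm_coeffQ_lt T hx hy hz h0 h1 h2, centroid_triangle, h0, h1, h2,
      hsum, circumOffset_affine]
    simp only [harm, map_add, map_mul, map_div₀, Complex.conj_conj, Complex.conj_ofNat] at hsum' ⊢
    linear_combination α * p / 3 * hsum + α * q / 3 * hsum'
  refine ⟨m, harm E.center p q (s / 3), E.center + circumOffset p q s 0, hm,
    fun α β => Set.ext fun X => ⟨?_, ?_⟩⟩
  · rintro ⟨T, hT', rfl⟩
    obtain ⟨x, y, z, hx, hy, hz, hp, hsum⟩ := hT T hT'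
    exact ⟨x * y * z, by simp [hx, hy, hz], (centers α β T x y z hx hy hz hp hsum).symm⟩
  · rintro ⟨l, hl1, rfl⟩
    obtain ⟨T, hT', x, y, z, hx, hy, hz, rfl, hp, hsum⟩ := hl l hl1
    exact ⟨T, hT', (centers α β T x y z hx hy hz hp hsum).symm⟩

theorem norm_sq_linear_comb (α β a b : ℂ) : ‖α * a + β * b‖ ^ 2 =
    ‖α‖ ^ 2 * ‖a‖ ^ 2 + 2 * (a * conj b * α * conj β).re + ‖β‖ ^ 2 * ‖b‖ ^ 2 := by
  simp only [← Complex.normSq_eq_norm_sq, Complex.normSq_apply, Complex.add_re,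
    Complex.add_im, Complex.mul_re, Complex.mul_im, Complex.conj_re, Complex.conj_im]
  ring

/-- The difference factors as a positive square times `(‖p‖² - ‖q‖²) (1 - ‖m‖²)`; `q ≠ 0` says that
the outer ellipse is not a circle. -/
theorem circumcenter_coeff_ne {p q m : ℂ} (hpq : ‖q‖ < ‖p‖) (hq : q ≠ 0) (hm : ‖m‖ < 1) :
    ‖p * conj q * (p - q * conj m) / (p * conj p - q * conj q)‖ ^ 2 -
      ‖conj p * q * (p * m - q) / (p * conj p - q * conj q)‖ ^ 2 ≠ 0 := by
  have hD := norm_pos_iff.mpr (mul_conj_sub_ne_zero hpq)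
  have hq' := norm_pos_iff.mpr hq
  have hp' := hq'.trans hpq
  have key : ‖p - q * conj m‖ ^ 2 - ‖p * m - q‖ ^ 2 =
      (‖p‖ ^ 2 - ‖q‖ ^ 2) * (1 - ‖m‖ ^ 2) := by
    simp only [← Complex.normSq_eq_norm_sq, Complex.normSq_apply, Complex.sub_re,
      Complex.sub_im, Complex.mul_re, Complex.mul_im, Complex.conj_re, Complex.conj_im]
    ring
  have h1 := sub_pos.mpr (pow_lt_pow_left₀ hpq (norm_nonneg _) two_ne_zero)
  have h2 : 0 < 1 - ‖m‖ ^ 2 := by nlinarith [norm_nonneg m]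
  have e : ‖p * conj q * (p - q * conj m) / (p * conj p - q * conj q)‖ ^ 2 -
      ‖conj p * q * (p * m - q) / (p * conj p - q * conj q)‖ ^ 2 =
      (‖p‖ * ‖q‖ / ‖p * conj p - q * conj q‖) ^ 2 *
        (‖p - q * conj m‖ ^ 2 - ‖p * m - q‖ ^ 2) := by
    simp only [norm_div, norm_mul, Complex.norm_conj]
    ring
  rw [e, key]
  positivity

theorem mainTheorem2 (E Ec : Ellipse) (hnested : Ec.curve ⊆ E.inside)
    (hporistic : ∃ T : Affine.Triangle ℝ ℂ, IsThreePeriodic E Ec T) :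
    ∃ (h₁₁ h₂₂ : ℝ) (h₁₂ : ℂ), (E.a ≠ E.b → h₂₂ ≠ 0) ∧
      ∀ α β : ℂ, ∃ (c : ℂ) (A B φ : ℝ), 0 ≤ B ∧ B ≤ A ∧
        centerLocus E Ec α β = ellipseCurve c A B φ ∧
        (0 < B ↔
          h₁₁ * ‖α‖ ^ 2 + 2 * (h₁₂ * α * (starRingEnd ℂ) β).re + h₂₂ * ‖β‖ ^ 2 ≠ 0) := by
  obtain ⟨m, c₂, c₃, hm, hlocus⟩ := centerLocus_eq_image E Ec hnested hporistic
  have hcirc : E.a ≠ E.b → _ := fun hab => circumcenter_coeff_ne E.norm_coeffQ_lt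
    (norm_pos_iff.mp (by
      rw [E.norm_coeffQ]; linarith [lt_of_le_of_ne E.b_le_a hab.symm])) hm
  set v₂ := E.coeffP * conj m / 3
  set w₂ := E.coeffQ * m / 3
  set v₃ := E.coeffP * conj E.coeffQ * (E.coeffP - E.coeffQ * conj m) /
    (E.coeffP * conj E.coeffP - E.coeffQ * conj E.coeffQ)
  set w₃ := conj E.coeffP * E.coeffQ * (E.coeffP * m - E.coeffQ) /
    (E.coeffP * conj E.coeffP - E.coeffQ * conj E.coeffQ)
  -- These are the coefficients of `‖α v₂ + β v₃‖² - ‖α w₂ + β w₃‖²`, which vanishes exactly when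
  -- the minor semi-axis does.
  refine ⟨‖v₂‖ ^ 2 - ‖w₂‖ ^ 2, ‖v₃‖ ^ 2 - ‖w₃‖ ^ 2, v₂ * conj v₃ - w₂ * conj w₃, hcirc,
    fun α β => ?_⟩
  obtain ⟨φ, hφ⟩ := harm_image_circle (α * c₂ + β * c₃) (α * v₂ + β * v₃) (α * w₂ + β * w₃)
  refine ⟨_, _, _, φ, abs_nonneg _, ?_, (hlocus α β).trans hφ, ?_⟩
  · rw [abs_le]
    constructor <;> linarith [norm_nonneg (α * v₂ + β * v₃), norm_nonneg (α * w₂ + β * w₃)]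
  · have e : (‖v₂‖ ^ 2 - ‖w₂‖ ^ 2) * ‖α‖ ^ 2 +
        2 * ((v₂ * conj v₃ - w₂ * conj w₃) * α * conj β).re + (‖v₃‖ ^ 2 - ‖w₃‖ ^ 2) * ‖β‖ ^ 2 =
        ‖α * v₂ + β * v₃‖ ^ 2 - ‖α * w₂ + β * w₃‖ ^ 2 := by
      rw [norm_sq_linear_comb, norm_sq_linear_comb, sub_mul (v₂ * conj v₃), sub_mul (_ * α),
        Complex.sub_re]
      ring
    rw [e, abs_pos, not_iff_not, sub_eq_zero, sub_eq_zero,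
      sq_eq_sq₀ (norm_nonneg _) (norm_nonneg _)]
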